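/- Let $E$ be a nonempty finite set, $X_+=E^{\mathbb Z_+}$, $X_-=E^{-\mathbb N}$ (sequences indexed by the negative integers), $X=E^{\mathbb Z}=X_-\times X_+$, with the product topologies and Borel $\sigma$-algebras. Let $S$ denote the left shift, $(Sx)_j=x_{j+1}$, on $X_+$ and on $X$, and for $\phi:X_+\to\mathbb R$ put $S_n\phi=\sum_{k=0}^{n-1}\phi\circ S^k$. A specification on $E^{\mathbb L}$ ($\mathbb L$ countable) is a family of measurable probability densities $\gamma_\Lambda(\xi_\Lambda|\eta_{\Lambda^c})$, $\Lambda\Subset\mathbb L$ finite, whose kernels $\gamma_\Lambda f(\eta)=\sum_{\xi\in E^\Lambda}\gamma_\Lambda(\xi_\Lambda|\eta_{\Lambda^c})f(\xi_\Lambda\eta_{\Lambda^c})$ satisfy $\gamma_\Lambda\gamma_\Delta=\gamma_\Lambda$ for $\Delta\subset\Lambda$. It is quasilocal if each $\gamma_\Lambda(\xi_\Lambda|\eta_{\Lambda^c})$ is continuous in $\eta$, non-null if $\inf_{\xi,\eta}\gamma_\Lambda(\xi_\Lambda|\eta_{\Lambda^c})>0$ for every $\Lambda$, and (for $\mathbb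 L=\mathbb Z$) translation-invariant if $\gamma_{\Lambda+k}(B|\omega)=\gamma_\Lambda(S^kB|S^k\omega)$ for all Borel $B$, all $\Lambda$, $k\in\mathbb Z$ and $\omega$. A probability measure $\mu$ is Gibbs for $\gamma$ if $\int\gamma_\Lambda f\,d\mu=\int f\,d\mu$ for all $f\in L^1(\mu)$ and all finite $\Lambda$. Let $\phi:X_+\to\mathbb R$ be continuous and satisfy the extensibility condition: for all $a,b\in E$ the functions $x\mapsto S_{n+1}\phi(x_{-n}^{-1}\,b\,x_1^\infty)-S_{n+1}\phi(x_{-n}^{-1}\,a\,x_1^\infty)$ converge uniformly in $x\in X$ as $n\to\infty$. Let $\nu$ be a Gibbs probability measure on $X_+$ for the half-line densities $$\overset{\rightharpoonup}{\gamma}^\phi_\Lambda(a_\Lambda|x_{\Lambda^c})=\frac{\exp\bigl(S_{n+1}\phi(a_\Lambda x_{\Lambda^c})\bigr)}{\sum_{\bar a_\Lambda}\exp\bigl(S_{n+1}\phi(\bar a_\Lambda x_{\Lambda^c})\bigr)},\qquad n=\max\Lambda,\ \Lambda\Subset\mathbb Z_+ .$$ Let $\rho$ be the uniform Bernoulli measure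 on $X_-$ and $\mu_0=\rho\times\nu$, a probability measure on $X$. Then there is a unique translation-invariant quasilocal non-null specification $\overset{\rightleftharpoons}{\gamma}^\phi$ on $X$ with single-site densities $$\overset{\rightleftharpoons}{\gamma}^\phi_{\{i\}}(\sigma_i|\omega_{\{i\}^c})=\lim_{p\to\infty}\frac{\exp\bigl(S_{i+p+1}\phi(\omega_{-p}^{i-1}\sigma_i\omega_{i+1}^\infty)\bigr)}{\sum_{a\in E}\exp\bigl(S_{i+p+1}\phi(\omega_{-p}^{i-1}a\,\omega_{i+1}^\infty)\bigr)}\qquad(i\in\mathbb Z),$$ and every weak$^*$ limit point $\mu$ of the sequence of probability measures $\tilde\mu_n=\frac1n\sum_{i=0}^{n-1}\mu_0\circ S^{-i}$, $n\ge1$, is a translation-invariant ($\mu\circ S^{-1}=\mu$) Gibbs measure for $\overset{\rightleftharpoons}{\gamma}^\phi$. -/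

import Mathlib

open MeasureTheory Filter Topology

namespace HalfLine

noncomputable section

section LatticeSystems

variable {L E : Type*} [DecidableEq L] [Fintype E]

/-- The concatenation `ξ_Λ η_{Λᶜ}`. -/
def glue (Λ : Finset L) (ξ : Λ → E) (η : L → E) : L → E :=
  fun i => if h : i ∈ Λ then ξ ⟨i, h⟩ else η i

/-- A family of densities `γ_Λ(σ_Λ | σ_{Λᶜ})`, indexed by the finite volumes `Λ` and written as
functions of the full configuration `σ`. Thus `γ_Λ(ξ_Λ | η_{Λᶜ})` is `γ Λ (glue Λ ξ η)`. -/
abbrev DensityFamily (L E : Type*) := Finset L → (L → E) → ℝ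

/-- The action of the kernel on functions,
`γ_Λ f (η) = ∑_{ξ ∈ E^Λ} γ_Λ(ξ_Λ | η_{Λᶜ}) f(ξ_Λ η_{Λᶜ})`. -/
def act (γ : DensityFamily L E) (Λ : Finset L) (f : (L → E) → ℝ) (η : L → E) : ℝ :=
  ∑ ξ : Λ → E, γ Λ (glue Λ ξ η) * f (glue Λ ξ η)

/-- The kernel itself, `γ_Λ(B | η)`. -/
def kernelProb (γ : DensityFamily L E) (Λ : Finset L) (B : Set (L → E)) (η : L → E) : ℝ :=
  act γ Λ (B.indicator 1) η

/-- A specification: a consistent family of (proper) probability kernels. As `E` is finite, such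
kernels are the same as measurable densities. Consistency is `γ_Λ γ_Δ = γ_Λ` for `Δ ⊆ Λ`. -/
structure IsSpecification [MeasurableSpace E] (γ : DensityFamily L E) : Prop where
  measurable : ∀ Λ : Finset L, Measurable (γ Λ)
  nonneg : ∀ (Λ : Finset L) (σ : L → E), 0 ≤ γ Λ σ
  sum_eq_one : ∀ (Λ : Finset L) (η : L → E), ∑ ξ : Λ → E, γ Λ (glue Λ ξ η) = 1
  consistent : ∀ Δ Λ : Finset L, Δ ⊆ Λ → ∀ (f : (L → E) → ℝ) (η : L → E),
    act γ Λ (act γ Δ f) η = act γ Λ f η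

/-- Quasilocality: every `γ_Λ(ξ_Λ | η)` is continuous in the boundary condition `η`. -/
def IsQuasilocal [TopologicalSpace E] (γ : DensityFamily L E) : Prop :=
  ∀ (Λ : Finset L) (ξ : Λ → E), Continuous fun η : L → E => γ Λ (glue Λ ξ η)

/-- Non-nullness: `inf_{ω, η} γ_Λ(ω_Λ | η_{Λᶜ}) > 0` for every finite `Λ`. -/
def IsNonNull (γ : DensityFamily L E) : Prop :=
  ∀ Λ : Finset L, ∃ c : ℝ, 0 < c ∧ ∀ (ξ : Λ → E) (η : L → E), c ≤ γ Λ (glue Λ ξ η)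

/-- The DLR equations: `∫ γ_Λ f dμ = ∫ f dμ` for all `f ∈ L¹(μ)` and all finite `Λ`. -/
def IsGibbs [MeasurableSpace E] (γ : DensityFamily L E) (μ : Measure (L → E)) : Prop :=
  ∀ (Λ : Finset L) (f : (L → E) → ℝ), Integrable f μ →
    Integrable (act γ Λ f) μ ∧ ∫ σ, act γ Λ f σ ∂μ = ∫ σ, f σ ∂μ

end LatticeSystems

section HalfAndWholeLine

variable {E : Type*}

/-- The left shift `S` on `X₊ = E^ℕ`. -/
def leftShift (x : ℕ → E) : ℕ → E := fun k => x (k + 1)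

/-- The Birkhoff sum `S_n φ (x) = ∑_{k<n} φ (S^k x)`. -/
def ergodicSum (φ : (ℕ → E) → ℝ) (n : ℕ) (x : ℕ → E) : ℝ := birkhoffSum leftShift φ n x

/-- The `k`-th power `S^k` (with `k ∈ ℤ`) of the left shift on `X = E^ℤ`. -/
def shift (k : ℤ) (x : ℤ → E) : ℤ → E := fun j => x (j + k)

/-- The half-line configuration `x_m^∞` seen from the site `m`. -/
def tail (m : ℤ) (x : ℤ → E) : ℕ → E := fun k => x (m + k)

/-- The densities of the half-line specification of the potential `φ`:
`exp (S_{n+1} φ (a_Λ x_{Λᶜ})) / ∑_{ā_Λ} exp (S_{n+1} φ (ā_Λ x_{Λᶜ}))` with `n = max Λ`. -/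
def halfLineDensity [Fintype E] (φ : (ℕ → E) → ℝ) : DensityFamily ℕ E := fun Λ x =>
  Real.exp (ergodicSum φ (Λ.sup id + 1) x) /
    ∑ a : Λ → E, Real.exp (ergodicSum φ (Λ.sup id + 1) (glue Λ a x))

/-- The extensibility condition: for all `a, b ∈ E`, the functions
`x ↦ S_{n+1} φ (x_{-n}^{-1} b x_1^∞) - S_{n+1} φ (x_{-n}^{-1} a x_1^∞)` converge uniformly on
`E^ℤ` as `n → ∞`. -/
def Extensible (φ : (ℕ → E) → ℝ) : Prop :=
  ∀ a b : E, ∃ F : (ℤ → E) → ℝ,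
    TendstoUniformly
      (fun (n : ℕ) (x : ℤ → E) =>
        ergodicSum φ (n + 1) (tail (-(n : ℤ)) (Function.update x 0 b)) -
          ergodicSum φ (n + 1) (tail (-(n : ℤ)) (Function.update x 0 a)))
      F atTop

/-- `exp (S_{i+p+1} φ (ω_{-p}^{i-1} ω_i ω_{i+1}^∞)) /
∑_a exp (S_{i+p+1} φ (ω_{-p}^{i-1} a ω_{i+1}^∞))` (meaningful for `p ≥ -i`). -/
def singleSiteApprox [Fintype E] (φ : (ℕ → E) → ℝ) (i : ℤ) (p : ℕ) (ω : ℤ → E) : ℝ :=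
  Real.exp (ergodicSum φ (i + p + 1).toNat (tail (-(p : ℤ)) ω)) /
    ∑ a : E, Real.exp
      (ergodicSum φ (i + p + 1).toNat (tail (-(p : ℤ)) (Function.update ω i a)))

/-- Translation-invariance: `γ_{Λ+k}(B | ω) = γ_Λ(S^k B | S^k ω)`. -/
def IsTranslationInvariant [Fintype E] [MeasurableSpace E] (γ : DensityFamily ℤ E) : Prop :=
  ∀ (B : Set (ℤ → E)), MeasurableSet B → ∀ (Λ : Finset ℤ) (k : ℤ) (ω : ℤ → E),
    kernelProb γ (Λ.image fun i => i + k) B ω = kernelProb γ Λ (shift k '' B) (shift k ω)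

/-- `γ` is a translation-invariant quasilocal non-null specification on `E^ℤ` whose single-site
densities are the limits, as `p → ∞`, of the half-line single-site densities. -/
structure IsWholeLineSpecification [Fintype E] [TopologicalSpace E] [MeasurableSpace E]
    (φ : (ℕ → E) → ℝ) (γ : DensityFamily ℤ E) : Prop where
  isSpecification : IsSpecification γ
  translationInvariant : IsTranslationInvariant γ
  quasilocal : IsQuasilocal γ
  nonNull : IsNonNull γ
  singleSite : ∀ (i : ℤ) (ω : ℤ → E),
    Tendsto (fun p : ℕ => singleSiteApprox φ i p ω) atTop (𝓝 (γ {i} ω))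

/-- The identification of `X₋ × X₊` with `X = E^ℤ`, where `X₋` is indexed by the negative
integers. -/
def joinLines (u : ({j : ℤ // j < 0} → E) × (ℕ → E)) : ℤ → E :=
  fun j => if h : j < 0 then u.1 ⟨j, h⟩ else u.2 j.toNat

variable [MeasurableSpace E]

lemma measurable_joinLines : Measurable (joinLines (E := E)) := by
  refine measurable_pi_lambda _ fun j => ?_
  by_cases h : j < 0
  · simp only [joinLines, h, dif_pos]
    exact (measurable_pi_apply _).comp measurable_fst
  · simp only [joinLines, h, dif_neg, not_false_eq_true]
    exact (measurable_pi_apply _).comp measurable_snd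

lemma measurable_shift (k : ℤ) : Measurable (shift (E := E) k) :=
  measurable_pi_lambda _ fun j => measurable_pi_apply (j + k)

/-- The uniform Bernoulli measure on `X₋`. -/
def uniformBernoulli (E : Type*) [Fintype E] [Nonempty E] [MeasurableSpace E] :
    Measure ({j : ℤ // j < 0} → E) :=
  Measure.infinitePi fun _ => (PMF.uniformOfFintype E).toMeasure

instance (E : Type*) [Fintype E] [Nonempty E] [MeasurableSpace E] :
    IsProbabilityMeasure (uniformBernoulli E) := by
  unfold uniformBernoulli; infer_instance

/-- `μ₀ = ρ × ν` on `X = X₋ × X₊`, with `ρ` the uniform Bernoulli measure on `X₋`. -/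
def initialMeasure [Fintype E] [Nonempty E] (ν : Measure (ℕ → E)) : Measure (ℤ → E) :=
  ((uniformBernoulli E).prod ν).map joinLines

instance [Fintype E] [Nonempty E] (ν : Measure (ℕ → E)) [IsProbabilityMeasure ν] :
    IsProbabilityMeasure (initialMeasure ν) :=
  Measure.isProbabilityMeasure_map measurable_joinLines.aemeasurable

/-- The averages of the shifted measures. To avoid division by zero, the `n`-th term is the
average over `n + 1` shifts, `(1 / (n + 1)) ∑_{i=0}^{n} μ₀ ∘ S^{-i}`. -/
def cesaroAverage (μ₀ : Measure (ℤ → E)) [IsProbabilityMeasure μ₀] (n : ℕ) :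
    ProbabilityMeasure (ℤ → E) :=
  ⟨((n + 1 : ℕ) : ENNReal)⁻¹ • ∑ i ∈ Finset.range (n + 1), μ₀.map (shift (i : ℤ)), by
    constructor
    have h : ∀ i : ℕ, (μ₀.map (shift (i : ℤ))) Set.univ = 1 := fun i => by
      rw [Measure.map_apply (measurable_shift _) MeasurableSet.univ]
      simp
    simp only [Measure.smul_apply, Measure.finsetSum_apply, h, Finset.sum_const,
      Finset.card_range, smul_eq_mul, nsmul_eq_mul, mul_one]
    exact ENNReal.inv_mul_cancel (by simp) (by simp)⟩

end HalfAndWholeLine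

end

end HalfLine

/-!
The sum of `φ` over a half-line `[m, ∞)` diverges in general, but its change when finitely many
sites are modified is a finite sum, additive under successive modifications. Extensibility says
that for a modification of a single site these changes converge uniformly as `m → -∞`; by
additivity the same holds for every finite volume, and the normalised exponentials of the limits
form the two-sided specification. Its positivity and consistency recover all its densities from
the single-site ones.

The measure `μ₀ ∘ S⁻ⁱ` satisfies the DLR equations on `[-i, ∞)` for the densities computed on that
half-line, because the shift carries them to the half-line densities of `ν`. As `i → ∞` these
densities converge uniformly to the two-sided ones, so the DLR equations hold asymptotically along
the shifts, hence along their averages, and pass to weak limits; the averaging makes the limits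
shift-invariant.
-/

namespace HalfLine

noncomputable section

section Cocycle

variable {L E ι : Type*}

/-- The pairs of configurations that agree at every site outside the finite volume `Λ`. -/
def agreeOff (Λ : Finset L) : Set ((L → E) × (L → E)) :=
  {q | Set.EqOn q.1 q.2 (Λ : Set L)ᶜ}

lemma agreeOff_mono {Δ Λ : Finset L} (h : Δ ⊆ Λ) : agreeOff (E := E) Δ ⊆ agreeOff Λ :=
  fun _ hq => hq.mono (Set.compl_subset_compl.2 (Finset.coe_subset.2 h))

lemma agreeOff_refl (Λ : Finset L) (σ : L → E) : (σ, σ) ∈ agreeOff Λ :=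
  Set.eqOn_refl σ _

lemma agreeOff_symm {Λ : Finset L} {σ τ : L → E} (h : (σ, τ) ∈ agreeOff Λ) :
    (τ, σ) ∈ agreeOff Λ :=
  Set.EqOn.symm h

lemma agreeOff_trans {Λ : Finset L} {σ τ υ : L → E} (h : (σ, τ) ∈ agreeOff Λ)
    (h' : (τ, υ) ∈ agreeOff Λ) : (σ, υ) ∈ agreeOff Λ :=
  Set.EqOn.trans h h'

lemma mk_update_mem_agreeOff_singleton [DecidableEq L] (σ : L → E) (i : L) (a : E) :
    (σ, Function.update σ i a) ∈ agreeOff {i} := fun l hl => by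
  simp only [Finset.coe_singleton, Set.mem_compl_iff, Set.mem_singleton_iff] at hl
  exact (Function.update_of_ne hl a σ).symm

lemma update_eq_of_mem_agreeOff_singleton [DecidableEq L] {i : L} {σ τ : L → E}
    (h : (σ, τ) ∈ agreeOff {i}) : Function.update σ i (τ i) = τ :=
  Function.update_eq_iff.2 ⟨rfl, fun _ hl => h (by simpa using hl)⟩

lemma mk_update_mem_agreeOff [DecidableEq L] {Λ : Finset L} {i : L} {σ τ : L → E}
    (h : (σ, τ) ∈ agreeOff (insert i Λ)) : (σ, Function.update τ i (σ i)) ∈ agreeOff Λ :=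
  fun l hl => by
    rcases eq_or_ne l i with rfl | hli
    · simp only [Function.update_self]
    · simp only [Function.update_of_ne hli]
      exact h (by simpa [hli] using hl)

/-- A function of pairs of configurations differing at finitely many sites, additive along
successive changes; it is to be thought of as the energy change `A σ τ = H τ - H σ`, even when no
total energy `H` exists. -/
def IsCocycle (A : (L → E) → (L → E) → ℝ) : Prop :=
  ∀ ⦃Λ : Finset L⦄ ⦃σ τ υ : L → E⦄, (σ, τ) ∈ agreeOff Λ → (τ, υ) ∈ agreeOff Λ →
    A σ τ + A τ υ = A σ υ

lemma IsCocycle.self {A : (L → E) → (L → E) → ℝ} (hA : IsCocycle A) (σ : L → E) : A σ σ = 0 :=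
  add_eq_left.1 (hA (agreeOff_refl ∅ σ) (agreeOff_refl ∅ σ))

variable {l : Filter ι} {A : ι → (L → E) → (L → E) → ℝ}

/- Change the sites of `Λ` one at a time and add up the energy changes. -/
lemma exists_tendstoUniformlyOn_agreeOff (hA : ∀ i, IsCocycle (A i))
    (hlim : ∀ j, ∃ F, TendstoUniformlyOn (fun i => Function.uncurry (A i)) F l (agreeOff {j}))
    (Λ : Finset L) :
    ∃ F, TendstoUniformlyOn (fun i => Function.uncurry (A i)) F l (agreeOff Λ) := by
  classical
  induction Λ using Finset.induction_on with
  | empty =>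
    refine ⟨0, TendstoUniformlyOn.congr (F := fun _ _ => 0)
      (fun u hu => .of_forall fun _ _ _ => refl_mem_uniformity hu) (.of_forall fun i q hq => ?_)⟩
    obtain ⟨σ, τ⟩ := q
    obtain rfl : σ = τ := funext fun l => hq (by simp)
    exact ((hA i).self σ).symm
  | insert j Λ _ ih =>
    obtain ⟨F, hF⟩ := ih
    obtain ⟨G, hG⟩ := hlim j
    let before (q : (L → E) × (L → E)) := (q.1, Function.update q.2 j (q.1 j))
    let after (q : (L → E) × (L → E)) := (Function.update q.2 j (q.1 j), q.2)
    have hbefore : agreeOff (insert j Λ) ⊆ before ⁻¹' agreeOff Λ :=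
      fun q hq => mk_update_mem_agreeOff hq
    have hafter : agreeOff (insert j Λ) ⊆ after ⁻¹' agreeOff {j} :=
      fun q _ => agreeOff_symm (mk_update_mem_agreeOff_singleton _ _ _)
    refine ⟨F ∘ before + G ∘ after, (((hF.comp before).mono hbefore).add
      ((hG.comp after).mono hafter)).congr (.of_forall fun i q hq => ?_)⟩
    exact hA i (Λ := insert j Λ) (agreeOff_mono (Finset.subset_insert _ _) (hbefore hq))
      (agreeOff_mono (by simp) (hafter hq))

/-- The pointwise limit of a family of cocycles, meaningful on pairs of configurations along which
the family converges. -/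
def limitCocycle (l : Filter ι) (A : ι → (L → E) → (L → E) → ℝ) (σ τ : L → E) : ℝ :=
  limUnder l fun i => A i σ τ

lemma tendstoUniformlyOn_limitCocycle [l.NeBot] (hA : ∀ i, IsCocycle (A i))
    (hlim : ∀ j, ∃ F, TendstoUniformlyOn (fun i => Function.uncurry (A i)) F l (agreeOff {j}))
    (Λ : Finset L) :
    TendstoUniformlyOn (fun i => Function.uncurry (A i)) (Function.uncurry (limitCocycle l A)) l
      (agreeOff Λ) := by
  obtain ⟨F, hF⟩ := exists_tendstoUniformlyOn_agreeOff hA hlim Λ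
  exact hF.congr_right fun q hq => (hF.tendsto_at hq).limUnder_eq.symm

lemma isCocycle_limitCocycle [l.NeBot] (hA : ∀ i, IsCocycle (A i))
    (hlim : ∀ j, ∃ F, TendstoUniformlyOn (fun i => Function.uncurry (A i)) F l (agreeOff {j})) :
    IsCocycle (limitCocycle l A) := fun Λ _ _ _ h h' => by
  have hpt := fun q hq => (tendstoUniformlyOn_limitCocycle hA hlim Λ).tendsto_at (x := q) hq
  refine tendsto_nhds_unique ?_ (hpt _ (agreeOff_trans h h'))
  exact ((hpt _ h).add (hpt _ h')).congr fun i => hA i h h'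

end Cocycle

section Variants

variable {L E : Type*} [DecidableEq L]

lemma glue_of_mem {Λ : Finset L} (ξ : Λ → E) (η : L → E) {l : L} (hl : l ∈ Λ) :
    glue Λ ξ η l = ξ ⟨l, hl⟩ :=
  dif_pos hl

lemma glue_of_notMem {Λ : Finset L} (ξ : Λ → E) (η : L → E) {l : L} (hl : l ∉ Λ) :
    glue Λ ξ η l = η l :=
  dif_neg hl

lemma glue_injective (Λ : Finset L) (η : L → E) :
    Function.Injective fun ξ : Λ → E => glue Λ ξ η := fun ξ ζ h => by
  funext l
  simpa only [glue_of_mem _ _ l.2] using congrFun h l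

lemma mk_glue_mem_agreeOff (Λ : Finset L) (ξ : Λ → E) (η : L → E) :
    (η, glue Λ ξ η) ∈ agreeOff Λ :=
  fun _ hl => (glue_of_notMem ξ η hl).symm

lemma glue_restrict_of_mem_agreeOff {Λ : Finset L} {η τ : L → E} (h : (η, τ) ∈ agreeOff Λ) :
    glue Λ (fun l => τ l) η = τ := by
  funext l
  by_cases hl : l ∈ Λ
  · exact glue_of_mem _ _ hl
  · exact (glue_of_notMem _ _ hl).trans (h hl)

lemma continuous_glue [TopologicalSpace E] (Λ : Finset L) (ξ : Λ → E) :
    Continuous (glue Λ ξ : (L → E) → L → E) := by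
  refine continuous_pi fun l => ?_
  by_cases hl : l ∈ Λ
  · simpa only [glue_of_mem _ _ hl] using continuous_const
  · simpa only [glue_of_notMem _ _ hl] using continuous_apply l

lemma measurable_glue [MeasurableSpace E] (Λ : Finset L) (ξ : Λ → E) :
    Measurable (glue Λ ξ : (L → E) → L → E) :=
  measurable_updateFinset_left

variable [Fintype E]

/-- The finitely many configurations that agree with `η` off `Λ`. -/
def variants (Λ : Finset L) (η : L → E) : Finset (L → E) :=
  Finset.univ.map ⟨fun ξ : Λ → E => glue Λ ξ η, glue_injective Λ η⟩

@[simp]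
lemma mem_variants {Λ : Finset L} {η τ : L → E} : τ ∈ variants Λ η ↔ (η, τ) ∈ agreeOff Λ := by
  simp only [variants, Finset.mem_map, Finset.mem_univ, true_and, Function.Embedding.coeFn_mk]
  exact ⟨fun ⟨ξ, hξ⟩ => hξ ▸ mk_glue_mem_agreeOff Λ ξ η,
    fun h => ⟨_, glue_restrict_of_mem_agreeOff h⟩⟩

lemma self_mem_variants (Λ : Finset L) (η : L → E) : η ∈ variants Λ η :=
  mem_variants.2 (agreeOff_refl Λ η)

lemma variants_congr {Λ : Finset L} {η η' : L → E} (h : (η, η') ∈ agreeOff Λ) :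
    variants Λ η = variants Λ η' := by
  ext τ
  simp only [mem_variants]
  exact ⟨agreeOff_trans (agreeOff_symm h), agreeOff_trans h⟩

lemma sum_glue (Λ : Finset L) (η : L → E) (G : (L → E) → ℝ) :
    ∑ ξ : Λ → E, G (glue Λ ξ η) = ∑ τ ∈ variants Λ η, G τ :=
  (Finset.sum_map Finset.univ ⟨_, glue_injective Λ η⟩ G).symm

lemma act_eq_sum_variants (γ : DensityFamily L E) (Λ : Finset L) (f : (L → E) → ℝ) (η : L → E) :
    act γ Λ f η = ∑ τ ∈ variants Λ η, γ Λ τ * f τ :=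
  sum_glue Λ η fun τ => γ Λ τ * f τ

lemma sum_variants_singleton (i : L) (η : L → E) (G : (L → E) → ℝ) :
    ∑ τ ∈ variants {i} η, G τ = ∑ a : E, G (Function.update η i a) :=
  Finset.sum_nbij' (fun τ => τ i) (fun a => Function.update η i a) (fun _ _ => Finset.mem_univ _)
    (fun a _ => mem_variants.2 (mk_update_mem_agreeOff_singleton η i a))
    (fun _ hτ => update_eq_of_mem_agreeOff_singleton (mem_variants.1 hτ))
    (fun a _ => Function.update_self i a η)
    (fun _ hτ => by rw [update_eq_of_mem_agreeOff_singleton (mem_variants.1 hτ)])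

/- Resampling in `Δ ⊆ Λ` is reversible for the counting measure on `E^Λ`. -/
lemma sum_variants_comm {Δ Λ : Finset L} (h : Δ ⊆ Λ) (K : (L → E) → (L → E) → ℝ) (η : L → E) :
    ∑ τ ∈ variants Λ η, ∑ υ ∈ variants Δ τ, K τ υ =
      ∑ τ ∈ variants Λ η, ∑ υ ∈ variants Δ τ, K υ τ := by
  refine Finset.sum_comm' fun τ υ => ?_
  simp only [mem_variants]
  exact ⟨fun ⟨hτ, hυ⟩ => ⟨agreeOff_symm hυ, agreeOff_trans hτ (agreeOff_mono h hυ)⟩,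
    fun ⟨hυ, hτ⟩ => ⟨agreeOff_trans hτ (agreeOff_mono h hυ), agreeOff_symm hυ⟩⟩

end Variants

section Relabelling

variable {L L' E : Type*}

/-- `J` copies configurations on `L` to configurations on `L'` along the injection `e` of sites,
filling the sites outside the range of `e` in a way that does not depend on the configuration. -/
structure IsRelabelling (e : L → L') (J : (L → E) → L' → E) : Prop where
  injective : Function.Injective e
  apply : ∀ x l, J x (e l) = x l
  eqOn_compl_range : ∀ x y, Set.EqOn (J x) (J y) (Set.range e)ᶜ

namespace IsRelabelling

variable {e : L → L'} {J : (L → E) → L' → E} [DecidableEq L']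

lemma mk_mem_agreeOff_image (hJ : IsRelabelling e J) {Λ : Finset L} {x y : L → E} :
    (J x, J y) ∈ agreeOff (Λ.image e) ↔ (x, y) ∈ agreeOff Λ := by
  refine ⟨fun h l hl => ?_, fun h l' hl' => ?_⟩
  · have := h (x := e l) (by simpa [hJ.injective.eq_iff] using hl)
    simpa only [hJ.apply] using this
  · by_cases hr : l' ∈ Set.range e
    · obtain ⟨l, rfl⟩ := hr
      simpa only [hJ.apply] using h fun hl => hl' (by simpa using ⟨l, hl, rfl⟩)
    · exact hJ.eqOn_compl_range x y hr

lemma apply_comp (hJ : IsRelabelling e J) {Λ : Finset L} {x : L → E} {τ : L' → E}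
    (h : (J x, τ) ∈ agreeOff (Λ.image e)) : J (τ ∘ e) = τ := by
  funext l'
  by_cases hr : l' ∈ Set.range e
  · obtain ⟨l, rfl⟩ := hr
    exact hJ.apply _ l
  · refine (hJ.eqOn_compl_range _ x hr).trans (h fun hl' => hr ?_)
    exact Set.mem_range_of_mem_image e (Λ : Set L) (by simpa using hl')

variable [DecidableEq L] [Fintype E]

lemma sum_variants (hJ : IsRelabelling e J) (Λ : Finset L) (x : L → E) (G : (L' → E) → ℝ) :
    ∑ τ ∈ variants (Λ.image e) (J x), G τ = ∑ y ∈ variants Λ x, G (J y) := by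
  refine Finset.sum_nbij' (fun τ => τ ∘ e) J (fun τ hτ => ?_)
    (fun y hy => mem_variants.2 (hJ.mk_mem_agreeOff_image.2 (mem_variants.1 hy)))
    (fun τ hτ => hJ.apply_comp (mem_variants.1 hτ)) (fun y _ => funext (hJ.apply y))
    (fun τ hτ => by rw [hJ.apply_comp (mem_variants.1 hτ)])
  rw [mem_variants] at hτ ⊢
  rwa [← hJ.mk_mem_agreeOff_image, hJ.apply_comp hτ]

lemma act_image (hJ : IsRelabelling e J) {γ : DensityFamily L E} {γ' : DensityFamily L' E}
    {Λ : Finset L} (hγ : ∀ x, γ' (Λ.image e) (J x) = γ Λ x) (f : (L' → E) → ℝ) (x : L → E) :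
    act γ' (Λ.image e) f (J x) = act γ Λ (f ∘ J) x := by
  simp only [act_eq_sum_variants, hJ.sum_variants, hγ, Function.comp_apply]

end IsRelabelling

end Relabelling

section Boltzmann

variable {L E : Type*} [DecidableEq L] [Fintype E]

/-- The family of densities `exp H / Z` of a function `H` known only through its changes
`A σ τ = H τ - H σ`: the conditional probability of `σ` given its values off `Λ` is
`1 / ∑ exp (A σ τ)`, the sum being over the configurations `τ` that agree with `σ` off `Λ`. -/
def boltzmann (A : (L → E) → (L → E) → ℝ) : DensityFamily L E := fun Λ σ =>
  (∑ τ ∈ variants Λ σ, Real.exp (A σ τ))⁻¹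

lemma sum_variants_exp_pos (H : (L → E) → ℝ) (Λ : Finset L) (η : L → E) :
    0 < ∑ τ ∈ variants Λ η, Real.exp (H τ) :=
  Finset.sum_pos (fun _ _ => Real.exp_pos _) ⟨η, self_mem_variants Λ η⟩

lemma boltzmann_pos (A : (L → E) → (L → E) → ℝ) (Λ : Finset L) (σ : L → E) :
    0 < boltzmann A Λ σ :=
  inv_pos.2 (sum_variants_exp_pos (A σ) Λ σ)

lemma boltzmann_eq_div {A : (L → E) → (L → E) → ℝ} {H : (L → E) → ℝ} {Λ : Finset L} {σ : L → E}
    (h : ∀ τ ∈ variants Λ σ, A σ τ = H τ - H σ) :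
    boltzmann A Λ σ = Real.exp (H σ) / ∑ τ ∈ variants Λ σ, Real.exp (H τ) := by
  have hsum : ∑ τ ∈ variants Λ σ, Real.exp (A σ τ) =
      (∑ τ ∈ variants Λ σ, Real.exp (H τ)) / Real.exp (H σ) := by
    rw [Finset.sum_div]
    exact Finset.sum_congr rfl fun τ hτ => by rw [h τ hτ, Real.exp_sub]
  rw [boltzmann, hsum, inv_div]

lemma IsCocycle.boltzmann_eq_exp_div {A : (L → E) → (L → E) → ℝ} (hA : IsCocycle A) {Λ : Finset L}
    {η τ : L → E} (h : (η, τ) ∈ agreeOff Λ) :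
    boltzmann A Λ τ = Real.exp (A η τ) / ∑ υ ∈ variants Λ η, Real.exp (A η υ) := by
  rw [variants_congr h]
  exact boltzmann_eq_div fun υ hυ => eq_sub_iff_add_eq'.2 (hA h (mem_variants.1 hυ))

lemma IsCocycle.boltzmann_eq_mul_exp {A : (L → E) → (L → E) → ℝ} (hA : IsCocycle A)
    {Λ : Finset L} {σ τ : L → E} (h : (σ, τ) ∈ agreeOff Λ) :
    boltzmann A Λ τ = boltzmann A Λ σ * Real.exp (A σ τ) := by
  rw [hA.boltzmann_eq_exp_div h, boltzmann, div_eq_inv_mul]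

lemma IsCocycle.boltzmann_mul_sum_boltzmann {A : (L → E) → (L → E) → ℝ} (hA : IsCocycle A)
    {Δ Λ : Finset L} (h : Δ ⊆ Λ) (σ : L → E) :
    boltzmann A Δ σ * ∑ τ ∈ variants Δ σ, boltzmann A Λ τ = boltzmann A Λ σ := by
  have hsum : ∑ τ ∈ variants Δ σ, boltzmann A Λ τ =
      boltzmann A Λ σ * ∑ τ ∈ variants Δ σ, Real.exp (A σ τ) := by
    rw [Finset.mul_sum]
    exact Finset.sum_congr rfl fun τ hτ =>
      hA.boltzmann_eq_mul_exp (agreeOff_mono h (mem_variants.1 hτ))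
  rw [hsum, boltzmann, mul_left_comm,
    inv_mul_cancel₀ (sum_variants_exp_pos (A σ) Δ σ).ne', mul_one]

lemma IsCocycle.isSpecification_boltzmann [MeasurableSpace E] {A : (L → E) → (L → E) → ℝ}
    (hA : IsCocycle A) (hmeas : ∀ Λ, Measurable (boltzmann A Λ)) :
    IsSpecification (boltzmann A) where
  measurable := hmeas
  nonneg Λ σ := (boltzmann_pos A Λ σ).le
  sum_eq_one Λ η := by
    rw [sum_glue, Finset.sum_congr rfl fun τ hτ => hA.boltzmann_eq_exp_div (mem_variants.1 hτ),
      ← Finset.sum_div, div_self (sum_variants_exp_pos (A η) Λ η).ne']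
  consistent Δ Λ h f η := by
    simp only [act_eq_sum_variants, Finset.mul_sum]
    rw [sum_variants_comm h fun τ υ => boltzmann A Λ τ * (boltzmann A Δ υ * f υ)]
    refine Finset.sum_congr rfl fun τ _ => ?_
    rw [← Finset.sum_mul, ← mul_assoc, mul_comm (∑ _ ∈ _, _), hA.boltzmann_mul_sum_boltzmann h]

lemma boltzmann_le_one {A : (L → E) → (L → E) → ℝ} (Λ : Finset L) {σ : L → E} (hσ : A σ σ = 0) :
    boltzmann A Λ σ ≤ 1 := by
  refine inv_le_one_of_one_le₀ ?_
  calc 1 = Real.exp (A σ σ) := by rw [hσ, Real.exp_zero]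
    _ ≤ ∑ τ ∈ variants Λ σ, Real.exp (A σ τ) :=
      Finset.single_le_sum (fun τ _ => (Real.exp_pos (A σ τ)).le) (self_mem_variants Λ σ)

lemma boltzmann_le_exp_mul {A B : (L → E) → (L → E) → ℝ} {Λ : Finset L} {σ : L → E} {ε : ℝ}
    (h : ∀ τ ∈ variants Λ σ, B σ τ ≤ ε + A σ τ) :
    boltzmann A Λ σ ≤ Real.exp ε * boltzmann B Λ σ := by
  have hsum : ∑ τ ∈ variants Λ σ, Real.exp (B σ τ) ≤
      Real.exp ε * ∑ τ ∈ variants Λ σ, Real.exp (A σ τ) := by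
    rw [Finset.mul_sum]
    refine Finset.sum_le_sum fun τ hτ => ?_
    rw [← Real.exp_add]
    exact Real.exp_le_exp.2 (h τ hτ)
  rw [boltzmann, boltzmann, ← div_eq_mul_inv, le_div_iff₀ (sum_variants_exp_pos _ Λ σ),
    inv_mul_le_iff₀ (sum_variants_exp_pos _ Λ σ)]
  rwa [mul_comm] at hsum

lemma abs_boltzmann_sub_le {A B : (L → E) → (L → E) → ℝ} {Λ : Finset L} {σ : L → E} {ε : ℝ}
    (hε : 0 ≤ ε) (hA : A σ σ = 0) (hB : B σ σ = 0)
    (h : ∀ τ ∈ variants Λ σ, |A σ τ - B σ τ| ≤ ε) :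
    |boltzmann A Λ σ - boltzmann B Λ σ| ≤ Real.exp ε - 1 := by
  have hAB : boltzmann A Λ σ ≤ Real.exp ε * boltzmann B Λ σ :=
    boltzmann_le_exp_mul fun τ hτ => by linarith [neg_le_of_abs_le (h τ hτ)]
  have hBA : boltzmann B Λ σ ≤ Real.exp ε * boltzmann A Λ σ :=
    boltzmann_le_exp_mul fun τ hτ => by linarith [le_of_abs_le (h τ hτ)]
  have hexp : 0 ≤ Real.exp ε - 1 := sub_nonneg.2 (Real.one_le_exp hε)
  refine abs_sub_le_iff.2 ⟨?_, ?_⟩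
  · linarith [mul_le_of_le_one_right hexp (boltzmann_le_one Λ hB)]
  · linarith [mul_le_of_le_one_right hexp (boltzmann_le_one Λ hA)]

lemma tendstoUniformly_boltzmann {ι : Type*} {l : Filter ι} {A : ι → (L → E) → (L → E) → ℝ}
    {B : (L → E) → (L → E) → ℝ} (hA : ∀ i, IsCocycle (A i)) (hB : IsCocycle B) {Λ : Finset L}
    (h : TendstoUniformlyOn (fun i => Function.uncurry (A i)) (Function.uncurry B) l
      (agreeOff Λ)) :
    TendstoUniformly (fun i => boltzmann (A i) Λ) (boltzmann B Λ) l := by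
  rw [Metric.tendstoUniformlyOn_iff] at h
  rw [Metric.tendstoUniformly_iff]
  intro ε hε
  have hlog : 0 < Real.log (1 + ε / 2) := Real.log_pos (by linarith)
  filter_upwards [h _ hlog] with i hi σ
  have hdist : ∀ τ ∈ variants Λ σ, |B σ τ - A i σ τ| ≤ Real.log (1 + ε / 2) :=
    fun τ hτ => (hi (σ, τ) (mem_variants.1 hτ)).le
  calc dist (boltzmann B Λ σ) (boltzmann (A i) Λ σ)
      ≤ Real.exp (Real.log (1 + ε / 2)) - 1 :=
        abs_boltzmann_sub_le hlog.le (hB.self σ) ((hA i).self σ) hdist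
    _ = ε / 2 := by rw [Real.exp_log (by linarith), add_sub_cancel_left]
    _ < ε := half_lt_self hε

lemma continuous_boltzmann [TopologicalSpace E] {A : (L → E) → (L → E) → ℝ} {Λ : Finset L}
    (hA : ∀ ξ : Λ → E, Continuous fun σ => A σ (glue Λ ξ σ)) : Continuous (boltzmann A Λ) := by
  refine Continuous.inv₀ ?_ fun σ => (sum_variants_exp_pos (A σ) Λ σ).ne'
  simp only [← sum_glue]
  exact continuous_finsetSum _ fun ξ _ => Real.continuous_exp.comp (hA ξ)

lemma IsRelabelling.boltzmann_image {L' : Type*} [DecidableEq L'] {e : L → L'}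
    {J : (L → E) → L' → E} (hJ : IsRelabelling e J) (A : (L' → E) → (L' → E) → ℝ) (Λ : Finset L)
    (x : L → E) :
    boltzmann A (Λ.image e) (J x) = boltzmann (fun y z => A (J y) (J z)) Λ x := by
  rw [boltzmann, boltzmann, hJ.sum_variants]

end Boltzmann

section Continuity

variable {L E : Type*} [DecidableEq L] [TopologicalSpace E] {γ : DensityFamily L E}

lemma isQuasilocal_of_continuous (hγ : ∀ Λ, Continuous (γ Λ)) : IsQuasilocal γ :=
  fun Λ ξ => (hγ Λ).comp (continuous_glue Λ ξ)

lemma isNonNull_of_continuous [CompactSpace E] (hγ : ∀ Λ, Continuous (γ Λ))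
    (hpos : ∀ Λ σ, 0 < γ Λ σ) : IsNonNull γ := fun Λ => by
  obtain ⟨c, hc, hle⟩ := isCompact_univ.exists_forall_le' (hγ Λ).continuousOn fun σ _ => hpos Λ σ
  exact ⟨c, hc, fun ξ η => hle _ (Set.mem_univ (glue Λ ξ η))⟩

end Continuity

section Uniqueness

variable {L E : Type*}

lemma eq_of_mem_agreeOff_of_forall_singleton {β : Type*} {f : (L → E) → β} {Λ : Finset L}
    (hf : ∀ i ∈ Λ, ∀ σ τ, (σ, τ) ∈ agreeOff {i} → f σ = f τ) {σ τ : L → E}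
    (h : (σ, τ) ∈ agreeOff Λ) : f σ = f τ := by
  classical
  induction Λ using Finset.induction_on generalizing τ with
  | empty => rw [show σ = τ from funext fun l => h (by simp)]
  | insert i Λ _ ih =>
    calc f σ = f (Function.update τ i (σ i)) :=
          ih (fun j hj => hf j (Finset.mem_insert_of_mem hj)) (mk_update_mem_agreeOff h)
      _ = f τ := hf i (Finset.mem_insert_self i Λ) _ _
          (agreeOff_symm (mk_update_mem_agreeOff_singleton τ i (σ i)))

variable [DecidableEq L] [Fintype E] [MeasurableSpace E] {γ γ' : DensityFamily L E}

namespace IsSpecification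

lemma sum_variants_eq_one (hγ : IsSpecification γ) (Λ : Finset L) (η : L → E) :
    ∑ τ ∈ variants Λ η, γ Λ τ = 1 := by
  rw [← sum_glue, hγ.sum_eq_one]

/- Consistency, tested on the indicator of the single configuration `σ`. -/
lemma mul_sum_variants (hγ : IsSpecification γ) {Δ Λ : Finset L} (h : Δ ⊆ Λ) (σ : L → E) :
    γ Δ σ * ∑ τ ∈ variants Δ σ, γ Λ τ = γ Λ σ := by
  classical
  have hcons := hγ.consistent Δ Λ h (Pi.single σ 1) σ
  simp only [act_eq_sum_variants, Finset.mul_sum] at hcons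
  rw [sum_variants_comm h fun τ υ => γ Λ τ * (γ Δ υ * (Pi.single σ 1 : (L → E) → ℝ) υ),
    Finset.sum_eq_single_of_mem σ (self_mem_variants Λ σ) fun τ _ hτ => by
      simp only [Pi.single_eq_of_ne hτ, mul_zero, Finset.sum_const_zero],
    Finset.sum_eq_single_of_mem σ (self_mem_variants Λ σ) fun τ _ hτ => by
      simp only [Pi.single_eq_of_ne hτ, mul_zero]] at hcons
  simp only [Pi.single_eq_same, mul_one] at hcons
  rw [← hcons, ← Finset.sum_mul, mul_comm]

lemma mul_singleton_comm (hγ : IsSpecification γ) {Λ : Finset L} {i : L} (hi : i ∈ Λ)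
    {σ τ : L → E} (h : (σ, τ) ∈ agreeOff {i}) : γ Λ σ * γ {i} τ = γ Λ τ * γ {i} σ := by
  rw [← hγ.mul_sum_variants (Finset.singleton_subset_iff.2 hi) σ,
    ← hγ.mul_sum_variants (Finset.singleton_subset_iff.2 hi) τ, variants_congr h]
  ring

/- Equal single-site densities make `γ' / γ` insensitive to every single site of the volume, and
normalization forces the resulting constant to be `1`. -/
theorem eq_of_singleton_eq (hγ : IsSpecification γ) (hγ' : IsSpecification γ')
    (hpos : ∀ Λ σ, 0 < γ Λ σ) (h : ∀ i, γ' {i} = γ {i}) : γ' = γ := by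
  funext Λ σ
  have hratio : ∀ τ ∈ variants Λ σ, γ' Λ τ = γ' Λ σ / γ Λ σ * γ Λ τ := fun τ hτ => by
    rw [← div_eq_iff (hpos Λ τ).ne']
    refine (eq_of_mem_agreeOff_of_forall_singleton (f := fun υ => γ' Λ υ / γ Λ υ)
      (fun i hi υ ω hυω => ?_) (mem_variants.1 hτ)).symm
    have hγi := hγ.mul_singleton_comm hi hυω
    have hγi' := hγ'.mul_singleton_comm hi hυω
    rw [h i] at hγi'
    rw [div_eq_div_iff (hpos Λ υ).ne' (hpos Λ ω).ne']
    refine mul_right_cancel₀ (mul_pos (hpos {i} υ) (hpos {i} ω)).ne' ?_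
    linear_combination γ Λ ω * γ {i} υ * hγi' - γ' Λ ω * γ {i} υ * hγi
  have hconst : γ' Λ σ / γ Λ σ = 1 := by
    rw [← hγ'.sum_variants_eq_one Λ σ, Finset.sum_congr rfl hratio, ← Finset.mul_sum,
      hγ.sum_variants_eq_one, mul_one]
  rw [(div_eq_one_iff_eq (hpos Λ σ).ne').1 hconst]

end IsSpecification

end Uniqueness

section Energy

variable {E : Type*}

lemma leftShift_iterate_apply (k : ℕ) (x : ℕ → E) (j : ℕ) : leftShift^[k] x j = x (j + k) := by
  induction k generalizing x with
  | zero => rfl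
  | succ k ih => rw [Function.iterate_succ_apply, ih]; rfl

lemma leftShift_iterate_congr {x y : ℕ → E} {n k : ℕ} (hnk : n ≤ k) (h : ∀ j ≥ n, x j = y j) :
    leftShift^[k] x = leftShift^[k] y := by
  funext j
  simpa only [leftShift_iterate_apply] using h (j + k) (by lia)

lemma tail_shift (m k : ℤ) (σ : ℤ → E) : tail m (shift k σ) = tail (m + k) σ :=
  funext fun j => congrArg σ (add_right_comm m j k)

lemma shift_shift_neg (k : ℤ) (σ : ℤ → E) : shift k (shift (-k) σ) = σ :=
  funext fun j => congrArg σ (add_neg_cancel_right j k)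

lemma shift_neg_shift (k : ℤ) (σ : ℤ → E) : shift (-k) (shift k σ) = σ :=
  funext fun j => congrArg σ (neg_add_cancel_right j k)

lemma isRelabelling_shift_neg (k : ℤ) :
    IsRelabelling (fun i : ℤ => i + k) (shift (E := E) (-k)) where
  injective := add_left_injective k
  apply x l := congrArg x (add_neg_cancel_right l k)
  eqOn_compl_range x y := by
    rw [(AddGroup.addRight_bijective k).surjective.range_eq, Set.compl_univ]
    exact Set.eqOn_empty _ _

lemma mk_shift_mem_agreeOff_zero {j : ℤ} {σ τ : ℤ → E} (h : (σ, τ) ∈ agreeOff {j}) :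
    (shift j σ, shift j τ) ∈ agreeOff {0} :=
  fun l hl => h (by simpa using hl)

lemma continuous_leftShift [TopologicalSpace E] : Continuous (leftShift (E := E)) :=
  continuous_pi fun _ => continuous_apply _

lemma continuous_tail [TopologicalSpace E] (m : ℤ) : Continuous (tail (E := E) m) :=
  continuous_pi fun _ => continuous_apply _

lemma continuous_shift [TopologicalSpace E] (k : ℤ) : Continuous (shift (E := E) k) :=
  continuous_pi fun _ => continuous_apply _

lemma continuous_ergodicSum [TopologicalSpace E] {φ : (ℕ → E) → ℝ} (hφ : Continuous φ) (n : ℕ) :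
    Continuous (ergodicSum φ n) := by
  unfold ergodicSum birkhoffSum
  exact continuous_finsetSum _ fun k _ => hφ.comp (continuous_leftShift.iterate k)

/-- The change `∑ₖ (φ (Sᵏ y) - φ (Sᵏ x))` of the Birkhoff sums of `φ`, a finite sum when `x` and
`y` differ at finitely many sites. -/
def halfLineCocycle (φ : (ℕ → E) → ℝ) (x y : ℕ → E) : ℝ :=
  ∑' k, (φ (leftShift^[k] y) - φ (leftShift^[k] x))

lemma halfLineCocycle_eq_sub (φ : (ℕ → E) → ℝ) {x y : ℕ → E} {n : ℕ} (h : ∀ j ≥ n, x j = y j) :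
    halfLineCocycle φ x y = ergodicSum φ n y - ergodicSum φ n x := by
  rw [halfLineCocycle, tsum_eq_sum (s := Finset.range n) fun k hk => ?_, Finset.sum_sub_distrib]
  · rfl
  · rw [leftShift_iterate_congr (not_lt.1 (Finset.mem_range.not.1 hk)) h, sub_self]

lemma halfLineDensity_eq_boltzmann [Fintype E] (φ : (ℕ → E) → ℝ) (Λ : Finset ℕ) (x : ℕ → E) :
    halfLineDensity φ Λ x = boltzmann (halfLineCocycle φ) Λ x := by
  rw [halfLineDensity, sum_glue Λ x fun y => Real.exp (ergodicSum φ (Λ.sup id + 1) y)]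
  refine (boltzmann_eq_div fun y hy => halfLineCocycle_eq_sub φ fun j hj => ?_).symm
  refine mem_variants.1 hy fun hjΛ => ?_
  exact absurd (Finset.le_sup (f := id) hjΛ) (not_le.2 (Nat.lt_of_succ_le hj))

/-- The energy change of the configurations restricted to the half-line `[m, ∞)`. -/
def truncatedCocycle (φ : (ℕ → E) → ℝ) (m : ℤ) (σ τ : ℤ → E) : ℝ :=
  halfLineCocycle φ (tail m σ) (tail m τ)

lemma truncatedCocycle_shift (φ : (ℕ → E) → ℝ) (m k : ℤ) (σ τ : ℤ → E) :
    truncatedCocycle φ m (shift k σ) (shift k τ) = truncatedCocycle φ (m + k) σ τ := by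
  simp only [truncatedCocycle, tail_shift]

lemma truncatedCocycle_eq_sub (φ : (ℕ → E) → ℝ) {m : ℤ} {Λ : Finset ℤ} {n : ℕ}
    (hn : ∀ l ∈ Λ, l < m + n) {σ τ : ℤ → E} (h : (σ, τ) ∈ agreeOff Λ) :
    truncatedCocycle φ m σ τ = ergodicSum φ n (tail m τ) - ergodicSum φ n (tail m σ) :=
  halfLineCocycle_eq_sub φ fun j hj => h fun hjΛ => by have := hn _ hjΛ; lia

lemma exists_forall_lt_add_natCast (m : ℤ) (Λ : Finset ℤ) : ∃ n : ℕ, ∀ l ∈ Λ, l < m + n := by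
  obtain ⟨M, hM⟩ := Λ.bddAbove
  exact ⟨(M - m + 1).toNat, fun l hl => by have := hM hl; lia⟩

lemma isCocycle_truncatedCocycle (φ : (ℕ → E) → ℝ) (m : ℤ) : IsCocycle (truncatedCocycle φ m) :=
  fun Λ σ τ υ h h' => by
    obtain ⟨n, hn⟩ := exists_forall_lt_add_natCast m Λ
    rw [truncatedCocycle_eq_sub φ hn h, truncatedCocycle_eq_sub φ hn h',
      truncatedCocycle_eq_sub φ hn (agreeOff_trans h h'), add_comm, sub_add_sub_cancel]

lemma continuous_truncatedCocycle_glue [TopologicalSpace E] {φ : (ℕ → E) → ℝ} (hφ : Continuous φ)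
    (m : ℤ) (Λ : Finset ℤ) (ξ : Λ → E) :
    Continuous fun σ => truncatedCocycle φ m σ (glue Λ ξ σ) := by
  obtain ⟨n, hn⟩ := exists_forall_lt_add_natCast m Λ
  simp only [fun σ => truncatedCocycle_eq_sub φ hn (mk_glue_mem_agreeOff Λ ξ σ)]
  have hsum : Continuous fun σ : ℤ → E => ergodicSum φ n (tail m σ) :=
    (continuous_ergodicSum hφ n).comp (continuous_tail m)
  exact (hsum.comp (continuous_glue Λ ξ)).sub hsum

/-- The energy change on the whole line. -/
def wholeLineCocycle (φ : (ℕ → E) → ℝ) : (ℤ → E) → (ℤ → E) → ℝ :=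
  limitCocycle atBot (truncatedCocycle φ)

lemma wholeLineCocycle_shift (φ : (ℕ → E) → ℝ) (k : ℤ) (σ τ : ℤ → E) :
    wholeLineCocycle φ (shift k σ) (shift k τ) = wholeLineCocycle φ σ τ := by
  simp only [wholeLineCocycle, limitCocycle, limUnder, truncatedCocycle_shift]
  change lim (map ((fun m => truncatedCocycle φ m σ τ) ∘ OrderIso.addRight k) atBot) = _
  rw [← map_map, OrderIso.map_atBot]

/- `Extensible` says this at the site `0` along `m = -n`, for each pair of symbols. -/
lemma Extensible.exists_tendstoUniformlyOn_zero [Finite E] {φ : (ℕ → E) → ℝ} (hφ : Extensible φ) :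
    ∃ F, TendstoUniformlyOn (fun m => Function.uncurry (truncatedCocycle φ m)) F atBot
      (agreeOff {0}) := by
  choose F hF using hφ
  refine ⟨fun q => F (q.1 0) (q.2 0) q.1, fun u hu => ?_⟩
  have hneg : Tendsto (fun m : ℤ => (-m).toNat) atBot atTop :=
    tendsto_atTop.2 fun n => (eventually_le_atBot (-n : ℤ)).mono fun m hm => by lia
  have hall := eventually_all.2 fun a => eventually_all.2 fun b => hneg.eventually (hF a b u hu)
  filter_upwards [hall, eventually_le_atBot 0] with m hm hm0
  rintro ⟨σ, τ⟩ hστ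
  have h := hm (σ 0) (τ 0) σ
  rw [Function.update_eq_self, update_eq_of_mem_agreeOff_singleton hστ,
    Int.toNat_of_nonneg (neg_nonneg.2 hm0), neg_neg] at h
  rwa [Function.uncurry_apply_pair,
    truncatedCocycle_eq_sub φ (n := (-m).toNat + 1) (fun l hl => ?_) hστ]
  rw [Finset.mem_singleton.1 hl]
  lia

lemma Extensible.exists_tendstoUniformlyOn_singleton [Finite E] {φ : (ℕ → E) → ℝ}
    (hφ : Extensible φ) (j : ℤ) :
    ∃ F, TendstoUniformlyOn (fun m => Function.uncurry (truncatedCocycle φ m)) F atBot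
      (agreeOff {j}) := by
  obtain ⟨F, hF⟩ := hφ.exists_tendstoUniformlyOn_zero
  refine ⟨fun q => F (shift j q.1, shift j q.2), fun u hu => ?_⟩
  filter_upwards [(tendsto_atBot_add_const_right atBot (-j) tendsto_id).eventually (hF u hu)]
    with m hm
  rintro ⟨σ, τ⟩ hq
  simpa only [id, Function.uncurry_apply_pair, truncatedCocycle_shift, neg_add_cancel_right]
    using hm _ (mk_shift_mem_agreeOff_zero hq)

lemma Extensible.isCocycle_wholeLineCocycle [Finite E] {φ : (ℕ → E) → ℝ} (hφ : Extensible φ) :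
    IsCocycle (wholeLineCocycle φ) :=
  isCocycle_limitCocycle (isCocycle_truncatedCocycle φ) hφ.exists_tendstoUniformlyOn_singleton

end Energy

section WholeLine

variable {E : Type*} [Fintype E] {φ : (ℕ → E) → ℝ}

/-- The conditional probabilities on `E^ℤ` that ignore the energy to the left of `m`. -/
def truncatedDensity (φ : (ℕ → E) → ℝ) (m : ℤ) : DensityFamily ℤ E :=
  boltzmann (truncatedCocycle φ m)

/-- The two-sided specification associated with `φ`. -/
def wholeLineDensity (φ : (ℕ → E) → ℝ) : DensityFamily ℤ E := boltzmann (wholeLineCocycle φ)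

lemma tendstoUniformly_truncatedDensity (hφ : Extensible φ) (Λ : Finset ℤ) :
    TendstoUniformly (fun m => truncatedDensity φ m Λ) (wholeLineDensity φ Λ) atBot :=
  tendstoUniformly_boltzmann (isCocycle_truncatedCocycle φ) hφ.isCocycle_wholeLineCocycle
    (tendstoUniformlyOn_limitCocycle (isCocycle_truncatedCocycle φ)
      hφ.exists_tendstoUniformlyOn_singleton Λ)

lemma singleSiteApprox_eq_truncatedDensity (φ : (ℕ → E) → ℝ) {i : ℤ} {p : ℕ} (hp : -i ≤ p)
    (ω : ℤ → E) : singleSiteApprox φ i p ω = truncatedDensity φ (-p) {i} ω := by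
  rw [singleSiteApprox, truncatedDensity, ← sum_variants_singleton i ω fun τ =>
    Real.exp (ergodicSum φ (i + p + 1).toNat (tail (-(p : ℤ)) τ))]
  refine (boltzmann_eq_div (H := fun τ => ergodicSum φ _ (tail (-(p : ℤ)) τ)) fun τ hτ =>
    truncatedCocycle_eq_sub φ (fun l hl => ?_) (mem_variants.1 hτ)).symm
  rw [Finset.mem_singleton.1 hl]
  lia

lemma tendsto_singleSiteApprox (hφ : Extensible φ) (i : ℤ) (ω : ℤ → E) :
    Tendsto (fun p : ℕ => singleSiteApprox φ i p ω) atTop (𝓝 (wholeLineDensity φ {i} ω)) := by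
  have hneg : Tendsto (fun p : ℕ => -(p : ℤ)) atTop atBot :=
    tendsto_neg_atTop_atBot.comp tendsto_natCast_atTop_atTop
  refine (((tendstoUniformly_truncatedDensity hφ {i}).tendsto_at ω).comp hneg).congr' ?_
  filter_upwards [eventually_ge_atTop (-i).toNat] with p hp
  exact (singleSiteApprox_eq_truncatedDensity φ (by lia) ω).symm

lemma wholeLineDensity_image (φ : (ℕ → E) → ℝ) (Λ : Finset ℤ) (k : ℤ) (σ : ℤ → E) :
    wholeLineDensity φ (Λ.image (· + k)) (shift (-k) σ) = wholeLineDensity φ Λ σ := by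
  simp only [wholeLineDensity, (isRelabelling_shift_neg k).boltzmann_image, wholeLineCocycle_shift]

lemma isTranslationInvariant_wholeLineDensity [MeasurableSpace E] (φ : (ℕ → E) → ℝ) :
    IsTranslationInvariant (wholeLineDensity φ) := fun B _ Λ k ω => by
  have hact := (isRelabelling_shift_neg k).act_image (wholeLineDensity_image φ Λ k)
    (B.indicator 1) (shift k ω)
  rw [shift_neg_shift] at hact
  rw [kernelProb, kernelProb, hact,
    Set.image_eq_preimage_of_inverse (shift_neg_shift k) (shift_shift_neg k)]
  rfl

variable [TopologicalSpace E]

lemma continuous_truncatedDensity (hφ : Continuous φ) (m : ℤ) (Λ : Finset ℤ) :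
    Continuous (truncatedDensity φ m Λ) :=
  continuous_boltzmann (continuous_truncatedCocycle_glue hφ m Λ)

lemma continuous_wholeLineDensity (hφ : Continuous φ) (hext : Extensible φ) (Λ : Finset ℤ) :
    Continuous (wholeLineDensity φ Λ) :=
  (tendstoUniformly_truncatedDensity hext Λ).continuous
    (.of_forall fun m => continuous_truncatedDensity hφ m Λ)

variable [MeasurableSpace E] [OpensMeasurableSpace E]

theorem isWholeLineSpecification_wholeLineDensity (hφ : Continuous φ) (hext : Extensible φ) :
    IsWholeLineSpecification φ (wholeLineDensity φ) where
  isSpecification := hext.isCocycle_wholeLineCocycle.isSpecification_boltzmann fun Λ =>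
    (continuous_wholeLineDensity hφ hext Λ).measurable
  translationInvariant := isTranslationInvariant_wholeLineDensity φ
  quasilocal := isQuasilocal_of_continuous (continuous_wholeLineDensity hφ hext)
  nonNull := isNonNull_of_continuous (continuous_wholeLineDensity hφ hext)
    (boltzmann_pos (wholeLineCocycle φ))
  singleSite := tendsto_singleSiteApprox hext

end WholeLine

section Gibbs

variable {L E : Type*} [DecidableEq L] [Fintype E] [MeasurableSpace E]
  {γ : DensityFamily L E} {μ : Measure (L → E)}

/-- The measure `μ γ_Λ`: the law of a `μ`-random configuration after its values in `Λ` have been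
redrawn according to `γ_Λ`. -/
def resample (γ : DensityFamily L E) (Λ : Finset L) (μ : Measure (L → E)) : Measure (L → E) :=
  ∑ ξ : Λ → E, (μ.withDensity fun η => (γ Λ (glue Λ ξ η)).toNNReal).map (glue Λ ξ)

namespace IsSpecification

lemma measurable_toNNReal_glue (hγ : IsSpecification γ) (Λ : Finset L) (ξ : Λ → E) :
    Measurable fun η => (γ Λ (glue Λ ξ η)).toNNReal :=
  measurable_real_toNNReal.comp ((hγ.measurable Λ).comp (measurable_glue Λ ξ))

lemma isProbabilityMeasure_resample [IsProbabilityMeasure μ] (hγ : IsSpecification γ)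
    (Λ : Finset L) : IsProbabilityMeasure (resample γ Λ μ) := by
  have hsum : ∀ η, ∑ ξ : Λ → E, ((γ Λ (glue Λ ξ η)).toNNReal : ENNReal) = 1 := fun η => by
    rw [← ENNReal.ofReal_one, ← hγ.sum_eq_one Λ η,
      ENNReal.ofReal_sum_of_nonneg fun ξ _ => hγ.nonneg Λ (glue Λ ξ η)]
    rfl
  constructor
  simp only [resample, Measure.finsetSum_apply,
    Measure.map_apply (measurable_glue Λ _) MeasurableSet.univ, Set.preimage_univ,
    withDensity_apply _ MeasurableSet.univ, Measure.restrict_univ]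
  rw [← lintegral_finsetSum _ fun ξ _ => (hγ.measurable_toNNReal_glue Λ ξ).coe_nnreal_ennreal]
  simp only [hsum, lintegral_const, measure_univ, mul_one]

lemma integrable_and_integral_act (hγ : IsSpecification γ) {Λ : Finset L} {f : (L → E) → ℝ}
    (hf : Integrable f (resample γ Λ μ)) :
    Integrable (act γ Λ f) μ ∧ ∫ σ, act γ Λ f σ ∂μ = ∫ σ, f σ ∂resample γ Λ μ := by
  have hpiece := fun ξ => integrable_finsetSum_measure.1 hf ξ (Finset.mem_univ ξ)
  have hsmul : ∀ (ξ : Λ → E) η, (γ Λ (glue Λ ξ η)).toNNReal • f (glue Λ ξ η) =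
      γ Λ (glue Λ ξ η) * f (glue Λ ξ η) := fun ξ η => by
    rw [NNReal.smul_def, Real.coe_toNNReal _ (hγ.nonneg Λ _), smul_eq_mul]
  have hint : ∀ ξ : Λ → E, Integrable (fun η => γ Λ (glue Λ ξ η) * f (glue Λ ξ η)) μ := fun ξ => by
    simpa only [Function.comp_apply, hsmul] using
      (integrable_withDensity_iff_integrable_smul (hγ.measurable_toNNReal_glue Λ ξ)).1
        ((hpiece ξ).comp_measurable (measurable_glue Λ ξ))
  refine ⟨integrable_finsetSum _ fun ξ _ => hint ξ, ?_⟩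
  rw [resample, integral_finsetSum_measure fun ξ _ => hpiece ξ]
  unfold act
  rw [integral_finsetSum _ fun ξ _ => hint ξ]
  refine Finset.sum_congr rfl fun ξ _ => ?_
  rw [integral_map (measurable_glue Λ ξ).aemeasurable (hpiece ξ).aestronglyMeasurable,
    integral_withDensity_eq_integral_smul (hγ.measurable_toNNReal_glue Λ ξ)]
  simp only [hsmul]

theorem isGibbs_of_forall_boundedContinuousFunction [Countable L] [TopologicalSpace E]
    [SecondCountableTopology E] [TopologicalSpace.PseudoMetrizableSpace E] [BorelSpace E]
    [IsProbabilityMeasure μ] (hγ : IsSpecification γ)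
    (h : ∀ (Λ : Finset L) (f : BoundedContinuousFunction (L → E) ℝ),
      ∫ σ, act γ Λ f σ ∂μ = ∫ σ, f σ ∂μ) : IsGibbs γ μ := fun Λ f hf => by
  have := hγ.isProbabilityMeasure_resample (μ := μ) Λ
  have hμ : resample γ Λ μ = μ := ext_of_forall_integral_eq_of_IsFiniteMeasure fun g => by
    rw [← (hγ.integrable_and_integral_act (g.integrable _)).2, h Λ g]
  rw [← hμ] at hf
  simpa only [hμ] using hγ.integrable_and_integral_act hf

end IsSpecification

end Gibbs

section Act

variable {L E : Type*} [DecidableEq L] [Fintype E]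

lemma continuous_act [TopologicalSpace E] {γ : DensityFamily L E} {Λ : Finset L}
    {f : (L → E) → ℝ} (hγ : Continuous (γ Λ)) (hf : Continuous f) : Continuous (act γ Λ f) :=
  continuous_finsetSum _ fun ξ _ => (hγ.mul hf).comp (continuous_glue Λ ξ)

lemma dist_act_le {γ γ' : DensityFamily L E} {Λ : Finset L} {f : (L → E) → ℝ} {δ C : ℝ}
    (hγ : ∀ σ, dist (γ Λ σ) (γ' Λ σ) ≤ δ) (hf : ∀ σ, |f σ| ≤ C) (η : L → E) :
    dist (act γ Λ f η) (act γ' Λ f η) ≤ Fintype.card (Λ → E) * (δ * C) := by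
  have hterm : ∀ σ, dist (γ Λ σ * f σ) (γ' Λ σ * f σ) ≤ δ * C := fun σ => by
    rw [Real.dist_eq, ← sub_mul, abs_mul]
    exact mul_le_mul (hγ σ) (hf σ) (abs_nonneg _) (dist_nonneg.trans (hγ σ))
  calc dist (act γ Λ f η) (act γ' Λ f η)
      ≤ ∑ _ξ : Λ → E, δ * C := dist_sum_sum_le_of_le _ fun ξ _ => hterm (glue Λ ξ η)
    _ = Fintype.card (Λ → E) * (δ * C) := by
      rw [Finset.sum_const, nsmul_eq_mul, Finset.card_univ]

lemma tendstoUniformly_act {ι : Type*} {l : Filter ι} {γ : ι → DensityFamily L E}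
    {γ' : DensityFamily L E} {Λ : Finset L} (hγ : TendstoUniformly (fun i => γ i Λ) (γ' Λ) l)
    {f : (L → E) → ℝ} {C : ℝ} (hf : ∀ σ, |f σ| ≤ C) :
    TendstoUniformly (fun i => act (γ i) Λ f) (act γ' Λ f) l := by
  rw [Metric.tendstoUniformly_iff] at hγ ⊢
  intro ε hε
  have hlim : Tendsto (fun δ : ℝ => Fintype.card (Λ → E) * (δ * C)) (𝓝[>] 0) (𝓝 0) :=
    tendsto_nhdsWithin_of_tendsto_nhds <| Continuous.tendsto' (by fun_prop) _ _ (by simp)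
  obtain ⟨δ, hδε, hδ⟩ := ((hlim.eventually (gt_mem_nhds hε)).and self_mem_nhdsWithin).exists
  filter_upwards [hγ δ hδ] with i hi η
  exact (dist_act_le (fun σ => (hi σ).le) hf η).trans_lt hδε

end Act

section ClusterPoint

variable {Ω : Type*} [MeasurableSpace Ω]

lemma integral_eq_of_mapClusterPt [TopologicalSpace Ω] [OpensMeasurableSpace Ω] {ι : Type*}
    {l : Filter ι} {P : ι → ProbabilityMeasure Ω} {μ : ProbabilityMeasure Ω}
    (hμ : MapClusterPt μ l P) (f : BoundedContinuousFunction Ω ℝ) {c : ℝ}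
    (h : Tendsto (fun i => ∫ ω, f ω ∂(P i : Measure Ω)) l (𝓝 c)) :
    ∫ ω, f ω ∂(μ : Measure Ω) = c := by
  have hclus := hμ.continuousAt_comp
    (ProbabilityMeasure.continuous_integral_boundedContinuousFunction f).continuousAt
  exact eq_of_nhds_neBot (hclus.neBot.mono (inf_le_inf le_rfl h))

lemma tendsto_integral_zero_of_tendstoUniformly {ι : Type*} {l : Filter ι} {μ : Measure Ω}
    [IsFiniteMeasure μ] {g : ι → Ω → ℝ} (hg : TendstoUniformly g 0 l) :
    Tendsto (fun i => ∫ ω, g i ω ∂μ) l (𝓝 0) := by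
  rw [Metric.tendstoUniformly_iff] at hg
  rw [Metric.tendsto_nhds]
  intro ε hε
  have hμ : 0 < μ.real Set.univ + 1 := by positivity
  filter_upwards [hg (ε / (μ.real Set.univ + 1)) (div_pos hε hμ)] with i hi
  rw [dist_zero_right]
  calc ‖∫ ω, g i ω ∂μ‖ ≤ ε / (μ.real Set.univ + 1) * μ.real Set.univ :=
        norm_integral_le_of_norm_le_const (ae_of_all _ fun ω => by simpa using (hi ω).le)
    _ < ε := by
      rw [div_mul_eq_mul_div, div_lt_iff₀ hμ]
      exact mul_lt_mul_of_pos_left (lt_add_one _) hε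

end ClusterPoint

section CesaroAverage

variable {E : Type*} [TopologicalSpace E] [SecondCountableTopology E] [MeasurableSpace E]

lemma integral_cesaroAverage [OpensMeasurableSpace E] (μ₀ : Measure (ℤ → E))
    [IsProbabilityMeasure μ₀] (f : BoundedContinuousFunction (ℤ → E) ℝ) (n : ℕ) :
    ∫ σ, f σ ∂(cesaroAverage μ₀ n : Measure (ℤ → E)) =
      ((n + 1 : ℕ) : ℝ)⁻¹ * ∑ i ∈ Finset.range (n + 1), ∫ σ, f (shift i σ) ∂μ₀ := by
  have : ∀ i : ℕ, IsProbabilityMeasure (μ₀.map (shift i)) := fun i =>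
    Measure.isProbabilityMeasure_map (measurable_shift _).aemeasurable
  change ∫ σ, f σ ∂(((n + 1 : ℕ) : ENNReal)⁻¹ • ∑ i ∈ Finset.range (n + 1), μ₀.map (shift i)) = _
  rw [integral_smul_measure, integral_finsetSum_measure fun i _ => f.integrable _,
    ENNReal.toReal_inv, ENNReal.toReal_natCast, smul_eq_mul]
  refine congrArg _ (Finset.sum_congr rfl fun i _ => ?_)
  exact integral_map (measurable_shift _).aemeasurable f.continuous.aestronglyMeasurable

lemma integral_eq_of_mapClusterPt_cesaroAverage [OpensMeasurableSpace E] {μ₀ : Measure (ℤ → E)}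
    [IsProbabilityMeasure μ₀] {μ : ProbabilityMeasure (ℤ → E)}
    (hμ : MapClusterPt μ atTop (cesaroAverage μ₀)) (f : BoundedContinuousFunction (ℤ → E) ℝ)
    {c : ℝ} (h : Tendsto (fun i : ℕ => ∫ σ, f (shift i σ) ∂μ₀) atTop (𝓝 c)) :
    ∫ σ, f σ ∂(μ : Measure (ℤ → E)) = c := by
  refine integral_eq_of_mapClusterPt hμ f ?_
  simp only [integral_cesaroAverage]
  exact h.cesaro.comp (tendsto_add_atTop_nat 1)

lemma integral_comp_shift_sub_cesaroAverage [OpensMeasurableSpace E] (μ₀ : Measure (ℤ → E))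
    [IsProbabilityMeasure μ₀] (f : BoundedContinuousFunction (ℤ → E) ℝ) (n : ℕ) :
    ∫ σ, (f.compContinuous ⟨shift 1, continuous_shift 1⟩ - f) σ
        ∂(cesaroAverage μ₀ n : Measure (ℤ → E)) =
      ((n + 1 : ℕ) : ℝ)⁻¹ * (∫ σ, f (shift (n + 1 : ℕ) σ) ∂μ₀ - ∫ σ, f (shift (0 : ℕ) σ) ∂μ₀) := by
  have hint : ∀ i : ℕ, Integrable (fun σ => f (shift i σ)) μ₀ := fun i =>
    (f.compContinuous ⟨shift i, continuous_shift i⟩).integrable μ₀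
  have hshift : ∀ (i : ℕ) (σ : ℤ → E), shift 1 (shift i σ) = shift (i + 1 : ℕ) σ := fun i σ =>
    funext fun j => congrArg σ (by push_cast; ring)
  rw [integral_cesaroAverage, ← Finset.sum_range_sub fun i : ℕ => ∫ σ, f (shift i σ) ∂μ₀]
  refine congrArg _ (Finset.sum_congr rfl fun i _ => ?_)
  rw [← integral_sub (hint (i + 1)) (hint i)]
  simp only [BoundedContinuousFunction.sub_apply, BoundedContinuousFunction.compContinuous_apply,
    ContinuousMap.coe_mk, hshift]

theorem measurePreserving_shift_of_mapClusterPt [TopologicalSpace.PseudoMetrizableSpace E]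
    [BorelSpace E] {μ₀ : Measure (ℤ → E)} [IsProbabilityMeasure μ₀]
    {μ : ProbabilityMeasure (ℤ → E)} (hμ : MapClusterPt μ atTop (cesaroAverage μ₀)) :
    MeasurePreserving (shift 1) (μ : Measure (ℤ → E)) (μ : Measure (ℤ → E)) := by
  refine ⟨measurable_shift 1, ?_⟩
  have := Measure.isProbabilityMeasure_map (μ := (μ : Measure (ℤ → E)))
    (measurable_shift (E := E) 1).aemeasurable
  refine ext_of_forall_integral_eq_of_IsFiniteMeasure fun f => ?_
  have hint : Integrable (fun σ => f (shift 1 σ)) (μ : Measure (ℤ → E)) :=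
    (f.compContinuous ⟨shift 1, continuous_shift 1⟩).integrable _
  rw [integral_map (measurable_shift 1).aemeasurable f.continuous.aestronglyMeasurable,
    ← sub_eq_zero, ← integral_sub hint (f.integrable _)]
  refine integral_eq_of_mapClusterPt hμ (f.compContinuous ⟨shift 1, continuous_shift 1⟩ - f) ?_
  simp only [integral_comp_shift_sub_cesaroAverage]
  have hbound : ∀ i : ℕ, |∫ σ, f (shift i σ) ∂μ₀| ≤ ‖f‖ := fun i => by
    simpa using norm_integral_le_of_norm_le_const (μ := μ₀) (f := fun σ => f (shift i σ))
      (ae_of_all _ fun σ => f.norm_coe_le_norm _)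
  have hinv : Tendsto (fun n : ℕ => ((n + 1 : ℕ) : ℝ)⁻¹) atTop (𝓝 0) :=
    tendsto_inv_atTop_nhds_zero_nat.comp (tendsto_add_atTop_nat 1)
  refine hinv.zero_mul_isBoundedUnder_le (isBoundedUnder_of ⟨‖f‖ + ‖f‖, fun n => ?_⟩)
  exact (abs_sub _ _).trans (add_le_add (hbound _) (hbound _))

end CesaroAverage

section JoinMeasure

variable {E : Type*} [MeasurableSpace E]

/-- The law on `E^ℤ` under which the two half-lines are independent with laws `ρ` and `ν`. -/
def joinMeasure (ρ : Measure ({j : ℤ // j < 0} → E)) (ν : Measure (ℕ → E)) : Measure (ℤ → E) :=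
  (ρ.prod ν).map joinLines

variable {ρ : Measure ({j : ℤ // j < 0} → E)} {ν : Measure (ℕ → E)} [IsProbabilityMeasure ρ]
  [IsProbabilityMeasure ν]

instance : IsProbabilityMeasure (joinMeasure ρ ν) :=
  Measure.isProbabilityMeasure_map measurable_joinLines.aemeasurable

lemma integral_joinMeasure {g : (ℤ → E) → ℝ} (hg : Integrable g (joinMeasure ρ ν)) :
    ∫ σ, g σ ∂joinMeasure ρ ν = ∫ u, ∫ x, g (joinLines (u, x)) ∂ν ∂ρ := by
  rw [joinMeasure] at hg ⊢
  rw [integral_map measurable_joinLines.aemeasurable hg.aestronglyMeasurable]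
  exact integral_prod _ (hg.comp_measurable measurable_joinLines)

end JoinMeasure

section LimitPoints

lemma integrable_comp_shift {E : Type*} [Finite E] [TopologicalSpace E] [MeasurableSpace E]
    [OpensMeasurableSpace E] (μ : Measure (ℤ → E)) [IsFiniteMeasure μ] (i : ℤ)
    {g : (ℤ → E) → ℝ} (hg : Continuous g) : Integrable (fun σ => g (shift i σ)) μ :=
  (BoundedContinuousFunction.mkOfCompact ⟨_, hg.comp (continuous_shift i)⟩).integrable μ

variable {E : Type*}

lemma isRelabelling_shift_joinLines (u : {j : ℤ // j < 0} → E) (i : ℤ) :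
    IsRelabelling (fun k : ℕ => (k : ℤ) - i) fun x => shift i (joinLines (u, x)) where
  injective k l h := by simpa using h
  apply x k := by simp [shift, joinLines]
  eqOn_compl_range x y l hl := by
    have hneg : l + i < 0 := not_le.1 fun h => hl ⟨(l + i).toNat, by lia⟩
    simp only [shift, joinLines, dif_pos hneg]

lemma tail_neg_shift_joinLines (u : {j : ℤ // j < 0} → E) (x : ℕ → E) (i : ℤ) :
    tail (-i) (shift i (joinLines (u, x))) = x := by
  funext k
  simp [tail, shift, joinLines]

variable [Fintype E] {φ : (ℕ → E) → ℝ}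

/- Seen from the site `-i`, the half-line `[-i, ∞)` of `Sⁱ σ` is the original half-line of `σ`. -/
lemma act_truncatedDensity_joinLines (φ : (ℕ → E) → ℝ) (u : {j : ℤ // j < 0} → E) (i : ℤ)
    (Λ : Finset ℕ) (f : (ℤ → E) → ℝ) (x : ℕ → E) :
    act (truncatedDensity φ (-i)) (Λ.image fun k : ℕ => (k : ℤ) - i) f
        (shift i (joinLines (u, x))) =
      act (halfLineDensity φ) Λ (fun y => f (shift i (joinLines (u, y)))) x := by
  refine (isRelabelling_shift_joinLines u i).act_image (fun y => ?_) f x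
  rw [halfLineDensity_eq_boltzmann, truncatedDensity,
    (isRelabelling_shift_joinLines u i).boltzmann_image]
  simp only [truncatedCocycle, tail_neg_shift_joinLines]

variable [TopologicalSpace E] [MeasurableSpace E]
  {ρ : Measure ({j : ℤ // j < 0} → E)} {ν : Measure (ℕ → E)} [IsProbabilityMeasure ρ]
  [IsProbabilityMeasure ν]

lemma integral_act_truncatedDensity_shift [OpensMeasurableSpace E] (hφ : Continuous φ)
    (hν : IsGibbs (halfLineDensity φ) ν) {Λ : Finset ℤ} {i : ℤ} (hΛ : ∀ l ∈ Λ, -i ≤ l)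
    (f : BoundedContinuousFunction (ℤ → E) ℝ) :
    ∫ σ, act (truncatedDensity φ (-i)) Λ f (shift i σ) ∂joinMeasure ρ ν =
      ∫ σ, f (shift i σ) ∂joinMeasure ρ ν := by
  obtain ⟨Δ, rfl⟩ : ∃ Δ : Finset ℕ, Λ = Δ.image fun k : ℕ => (k : ℤ) - i := by
    refine ⟨Λ.image fun l => (l + i).toNat, ?_⟩
    rw [Finset.image_image, Finset.image_congr (g := id) fun l hl => ?_, Finset.image_id]
    have := hΛ l hl
    simp only [Function.comp_apply, id]
    lia
  rw [integral_joinMeasure (integrable_comp_shift _ i f.continuous), integral_joinMeasure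
    (integrable_comp_shift _ i (continuous_act (continuous_truncatedDensity hφ _ _) f.continuous))]
  refine integral_congr_ae (ae_of_all _ fun u => ?_)
  simp only [act_truncatedDensity_joinLines]
  refine (hν Δ _ (Integrable.of_bound (C := ‖f‖) ?_ (ae_of_all _ fun x => f.norm_coe_le_norm _))).2
  exact f.continuous.measurable.comp ((measurable_shift i).comp
    (measurable_joinLines.comp measurable_prodMk_left)) |>.aestronglyMeasurable

lemma tendsto_integral_act_wholeLineDensity_sub [OpensMeasurableSpace E] (hφ : Continuous φ)
    (hext : Extensible φ) (hν : IsGibbs (halfLineDensity φ) ν) (Λ : Finset ℤ)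
    (f : BoundedContinuousFunction (ℤ → E) ℝ) :
    Tendsto (fun i : ℕ => ∫ σ, (act (wholeLineDensity φ) Λ f (shift i σ) - f (shift i σ))
      ∂joinMeasure ρ ν) atTop (𝓝 0) := by
  have hneg : Tendsto (fun i : ℕ => -(i : ℤ)) atTop atBot :=
    tendsto_neg_atTop_atBot.comp tendsto_natCast_atTop_atTop
  have hact := tendstoUniformly_act (tendstoUniformly_truncatedDensity hext Λ)
    (f := f) (C := ‖f‖) fun σ => f.norm_coe_le_norm σ
  have hunif : TendstoUniformly (fun (i : ℕ) σ => act (wholeLineDensity φ) Λ f (shift i σ) -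
      act (truncatedDensity φ (-i)) Λ f (shift i σ)) 0 atTop := by
    rw [Metric.tendstoUniformly_iff] at hact ⊢
    intro ε hε
    filter_upwards [hneg.eventually (hact ε hε)] with i hi σ
    rw [Pi.zero_apply, dist_zero_left, ← dist_eq_norm]
    exact hi (shift i σ)
  obtain ⟨b, hb⟩ := Λ.bddBelow
  refine (tendsto_integral_zero_of_tendstoUniformly (μ := joinMeasure ρ ν) hunif).congr' ?_
  filter_upwards [hneg.eventually (eventually_le_atBot b)] with i hi
  have hf := integrable_comp_shift (joinMeasure ρ ν) i f.continuous
  have hwhole := integrable_comp_shift (joinMeasure ρ ν) i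
    (continuous_act (continuous_wholeLineDensity hφ hext Λ) f.continuous)
  have htrunc := integrable_comp_shift (joinMeasure ρ ν) i
    (continuous_act (continuous_truncatedDensity hφ (-i) Λ) f.continuous)
  rw [integral_sub hwhole htrunc, integral_sub hwhole hf,
    integral_act_truncatedDensity_shift hφ hν (fun l hl => hi.trans (hb hl)) f]

theorem isGibbs_wholeLineDensity_of_mapClusterPt [TopologicalSpace.PseudoMetrizableSpace E]
    [BorelSpace E] (hφ : Continuous φ) (hext : Extensible φ) (hν : IsGibbs (halfLineDensity φ) ν)
    {μ : ProbabilityMeasure (ℤ → E)}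
    (hμ : MapClusterPt μ atTop (cesaroAverage (joinMeasure ρ ν))) :
    IsGibbs (wholeLineDensity φ) (μ : Measure (ℤ → E)) := by
  have hspec := (isWholeLineSpecification_wholeLineDensity hφ hext).isSpecification
  refine hspec.isGibbs_of_forall_boundedContinuousFunction fun Λ f => ?_
  let g : BoundedContinuousFunction (ℤ → E) ℝ := .mkOfCompact
    ⟨_, continuous_act (continuous_wholeLineDensity hφ hext Λ) f.continuous⟩
  have hzero := integral_eq_of_mapClusterPt_cesaroAverage hμ (g - f)
    (tendsto_integral_act_wholeLineDensity_sub hφ hext hν Λ f)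
  exact sub_eq_zero.1 ((integral_sub (g.integrable _) (f.integrable _)).symm.trans hzero)

end LimitPoints

end

end HalfLine

open HalfLine in
theorem theoremB_general {E : Type*} [Fintype E] [TopologicalSpace E]
    [TopologicalSpace.PseudoMetrizableSpace E] [MeasurableSpace E] [BorelSpace E]
    {φ : (ℕ → E) → ℝ} (hφ : Continuous φ) (hext : Extensible φ)
    {ρ : Measure ({j : ℤ // j < 0} → E)} [IsProbabilityMeasure ρ]
    {ν : Measure (ℕ → E)} [IsProbabilityMeasure ν] (hν : IsGibbs (halfLineDensity φ) ν)
    {μ : ProbabilityMeasure (ℤ → E)}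
    (hμ : MapClusterPt μ atTop (cesaroAverage (joinMeasure ρ ν))) :
    ∃ γ : DensityFamily ℤ E,
      IsWholeLineSpecification φ γ ∧
      (∀ γ' : DensityFamily ℤ E, IsSpecification γ' →
        (∀ i ω, Tendsto (fun p : ℕ => singleSiteApprox φ i p ω) atTop (𝓝 (γ' {i} ω))) → γ' = γ) ∧
      IsGibbs γ (μ : Measure (ℤ → E)) ∧
      MeasurePreserving (shift 1) (μ : Measure (ℤ → E)) (μ : Measure (ℤ → E)) := by
  have hspec := isWholeLineSpecification_wholeLineDensity hφ hext
  refine ⟨wholeLineDensity φ, hspec, fun γ' hγ' hsite => ?_,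
    isGibbs_wholeLineDensity_of_mapClusterPt hφ hext hν hμ,
    measurePreserving_shift_of_mapClusterPt hμ⟩
  refine hspec.isSpecification.eq_of_singleton_eq hγ' (boltzmann_pos (wholeLineCocycle φ))
    fun i => funext fun ω => ?_
  exact tendsto_nhds_unique (hsite i ω) (hspec.singleSite i ω)

theorem theoremB {E : Type*} [Fintype E] [Nonempty E] [TopologicalSpace E] [DiscreteTopology E]
    [MeasurableSpace E] [BorelSpace E]
    (φ : (ℕ → E) → ℝ) (hφ : Continuous φ) (hext : HalfLine.Extensible φ)
    (ν : Measure (ℕ → E)) [IsProbabilityMeasure ν]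
    (hν : HalfLine.IsGibbs (HalfLine.halfLineDensity φ) ν)
    (μ : ProbabilityMeasure (ℤ → E))
    (hμ : MapClusterPt μ atTop
      (fun n : ℕ => HalfLine.cesaroAverage (HalfLine.initialMeasure ν) n)) :
    ∃ γ : HalfLine.DensityFamily ℤ E,
      HalfLine.IsWholeLineSpecification φ γ ∧
      (∀ γ' : HalfLine.DensityFamily ℤ E, HalfLine.IsWholeLineSpecification φ γ' → γ' = γ) ∧
      HalfLine.IsGibbs γ (μ : Measure (ℤ → E)) ∧
      MeasurePreserving (HalfLine.shift 1) (μ : Measure (ℤ → E)) (μ : Measure (ℤ → E)) := by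
  obtain ⟨γ, hγ, huniq, hgibbs, hinv⟩ := theoremB_general hφ hext hν hμ
  exact ⟨γ, hγ, fun γ' hγ' => huniq γ' hγ'.isSpecification hγ'.singleSite, hgibbs, hinv⟩
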